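/- Let $G$ be a totally disconnected, locally compact topological group. Let $\operatorname{Sub}(G)$ be the set of closed subgroups of $G$ with the Chabauty topology, i.e. the topology generated by the sets $\{H : H\cap U\neq\varnothing\}$ for $U\subseteq G$ open and $\{H : H\cap K=\varnothing\}$ for $K\subseteq G$ compact. Let $\operatorname{Aut}(G)$ be the group of topological automorphisms of $G$, acting on $\operatorname{Sub}(G)$ by $\varphi\cdot H=\varphi(H)$, and let $\operatorname{Inn}(G)\le\operatorname{Aut}(G)$ be the group of inner automorphisms. For $\Gamma\le\operatorname{Aut}(G)$, a minimal subgroup system of $(G,\Gamma)$ is a non-empty, closed, $\Gamma$-invariant subset $\mathcal Y\subseteq\operatorname{Sub}(G)$ that has no non-empty, closed, $\Gamma$-invariant proper subset; a URS (uniformly recurrent subgroup) of $G$ is a minimal subgroup system of $(G,\operatorname{Inn}(G))$. Let $\Gamma$ be a group with $\operatorname{Inn}(G)\le\Gamma\le\operatorname{Aut}(G)$ and let $\mathcal Y$ be a minimal subgroup system of $(G,\Gamma)$ all of whose elements are compact. Then $\bigcup\mathcal Y$ is contained in a compact subgroup $K\le G$ that is $\Gamma$-invariant, i.e. $\varphi(K)=K$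 for all $\varphi\in\Gamma$. In particular, if $\mathcal Y$ is a URS of $G$ consisting of compact subgroups, then $\bigcup\mathcal Y$ is contained in a compact normal subgroup of $G$. -/

import Mathlib

open Set TopologicalSpace

/-- The Chabauty topology on the space of closed subsets of `M`: it is generated by the sets
`Hit(U) = {A | A ∩ U ≠ ∅}`, `U` open, and `Miss(K) = {A | A ∩ K = ∅}`, `K` compact. -/
abbrev chabautyTopology (M : Type*) [TopologicalSpace M] : TopologicalSpace (Closeds M) :=
  generateFrom
    ({s | ∃ U : Set M, IsOpen U ∧ s = {A : Closeds M | ((A : Set M) ∩ U).Nonempty}} ∪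
      {s | ∃ K : Set M, IsCompact K ∧ s = {A : Closeds M | (A : Set M) ∩ K = ∅}})

namespace ClosedSubgroup

variable {G : Type*} [Group G] [TopologicalSpace G]

/-- A closed subgroup, regarded as a closed subset. -/
def toCloseds (H : ClosedSubgroup G) : Closeds G := ⟨(H : Set G), H.isClosed'⟩

/-- `Sub(G)`: the type of closed subgroups carries the subspace topology of the Chabauty
topology on closed subsets. -/
instance chabauty : TopologicalSpace (ClosedSubgroup G) :=
  TopologicalSpace.induced toCloseds (chabautyTopology G)

end ClosedSubgroup

section Automorphisms

variable {G : Type*} [Group G] [TopologicalSpace G]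

/-- `Aut(G)`: the bicontinuous automorphisms of `G` form a group under composition. -/
instance topAutGroup : Group (G ≃ₜ* G) where
  mul φ ψ := ψ.trans φ
  one := ContinuousMulEquiv.refl G
  inv φ := φ.symm
  mul_assoc _ _ _ := rfl
  one_mul _ := rfl
  mul_one _ := rfl
  inv_mul_cancel φ := ContinuousMulEquiv.ext φ.symm_apply_apply

/-- The image of a closed subgroup under a topological automorphism. -/
def ClosedSubgroup.image (φ : G ≃ₜ* G) (H : ClosedSubgroup G) : ClosedSubgroup G where
  toSubgroup := H.toSubgroup.map φ.toMulEquiv.toMonoidHom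
  isClosed' := φ.toHomeomorph.isClosedMap _ H.isClosed'

/-- `Aut(G)` acts on `Sub(G)` by `φ • H = φ(H)`. -/
instance topAutAction : MulAction (G ≃ₜ* G) (ClosedSubgroup G) where
  smul φ H := ClosedSubgroup.image φ H
  one_smul H := SetLike.coe_injective (Set.image_id (H : Set G))
  mul_smul φ ψ H := SetLike.coe_injective (Set.image_comp φ ψ (H : Set G))

/-- The conjugation `x ↦ g * x * g⁻¹` as a topological automorphism. -/
def innerAut [IsTopologicalGroup G] (g : G) : G ≃ₜ* G where
  toMulEquiv := MulAut.conj g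
  continuous_toFun := by
    change Continuous fun x => g * x * g⁻¹
    fun_prop
  continuous_invFun := by
    change Continuous fun x => g⁻¹ * x * g
    fun_prop

/-- `Inn(G)`, as a subgroup of `Aut(G)`. -/
def Inn (G : Type*) [Group G] [TopologicalSpace G] [IsTopologicalGroup G] :
    Subgroup (G ≃ₜ* G) where
  carrier := Set.range innerAut
  mul_mem' := by
    rintro _ _ ⟨g, rfl⟩ ⟨h, rfl⟩
    exact ⟨g * h, ContinuousMulEquiv.ext fun x =>
      DFunLike.congr_fun (map_mul MulAut.conj g h) x⟩
  one_mem' := ⟨1, ContinuousMulEquiv.ext fun x =>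
    DFunLike.congr_fun (map_one (MulAut.conj (G := G))) x⟩
  inv_mem' := by
    rintro _ ⟨g, rfl⟩
    exact ⟨g⁻¹, ContinuousMulEquiv.ext fun x =>
      DFunLike.congr_fun (map_inv MulAut.conj g) x⟩

end Automorphisms

/-- `Y` is a minimal subsystem of the `Γ`-space `X`: it is non-empty, closed and `Γ`-invariant,
and it has no non-empty closed `Γ`-invariant proper subset. -/
structure IsMinimalSubsystem (Γ : Type*) {X : Type*} [Group Γ] [MulAction Γ X]
    [TopologicalSpace X] (Y : Set X) : Prop where
  nonempty : Y.Nonempty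
  isClosed : IsClosed Y
  invariant : ∀ γ : Γ, ∀ y ∈ Y, γ • y ∈ Y
  minimal : ∀ Z : Set X, Z ⊆ Y → Z.Nonempty → IsClosed Z →
    (∀ γ : Γ, ∀ z ∈ Z, γ • z ∈ Z) → Z = Y

/-- A minimal subgroup system of `(G, Γ)`: a minimal subsystem of `Sub(G)` for the action of the
group `Γ` of topological automorphisms. -/
def IsMinimalSubgroupSystem {G : Type*} [Group G] [TopologicalSpace G]
    (Γ : Subgroup (G ≃ₜ* G)) (Y : Set (ClosedSubgroup G)) : Prop :=
  IsMinimalSubsystem Γ Y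

/-- A uniformly recurrent subgroup of `G`: a minimal subgroup system for `Inn(G)`. -/
def IsURS {G : Type*} [Group G] [TopologicalSpace G] [IsTopologicalGroup G]
    (Y : Set (ClosedSubgroup G)) : Prop :=
  IsMinimalSubgroupSystem (Inn G) Y

/-! Fix a compact open subgroup `U` and let `S` be the union of the members of `Y`. Each member,
being compact, meets finitely many cosets of `U`, and this finite set is lower semicontinuous in the
member. As `Y` is compact Hausdorff, Baire category makes it constant on some nonempty open set. By
minimality every orbit enters that set, and by compactness of `Y` finitely many elements of `Γ`
suffice, so `S` lies in a compact set (`IsMinimalSubgroupSystem.finite_image_mk_iUnion`).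

Moreover `S` is conjugation-invariant and its elements have powers in `U`. Dicman's argument modulo
`U` (`Subgroup.finite_image_mk_closure`) then shows that the subgroup generated by `S` meets
finitely many cosets of `U`; its closure is the required `K`. -/

/-! ### Dicman's lemma relative to a subgroup. -/

section Dicman

variable {G : Type*} [Group G]

/-- Copies of `r` move to the front; each letter they pass is conjugated by a power of `r` and so
stays in `S`. -/
theorem List.exists_pow_mul_prod_of_le_count [DecidableEq G] {S : Set G}
    (hconj : ∀ g : G, ∀ s ∈ S, g * s * g⁻¹ ∈ S) (r : G) (l : List G) (hl : ∀ x ∈ l, x ∈ S) :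
    ∀ k ≤ l.count r, ∃ l' : List G, (∀ x ∈ l', x ∈ S) ∧ l'.length + k = l.length ∧
      l.prod = r ^ k * l'.prod := by
  induction l with
  | nil =>
    intro k hk
    obtain rfl : k = 0 := by simpa using hk
    exact ⟨[], by simp, by simp, by simp⟩
  | cons a l ih =>
    have ih := ih fun x hx => hl x (List.mem_cons_of_mem _ hx)
    have ha : a ∈ S := hl a List.mem_cons_self
    intro k hk
    by_cases h : a = r
    · subst h
      rcases k with _ | k
      · exact ⟨a :: l, hl, by simp, by simp⟩
      · obtain ⟨l', h₁, h₂, h₃⟩ := ih k (by simpa using hk)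
        exact ⟨l', h₁, by simp; omega, by rw [List.prod_cons, h₃, pow_succ', mul_assoc]⟩
    · rw [List.count_cons_of_ne h] at hk
      obtain ⟨l', h₁, h₂, h₃⟩ := ih k hk
      refine ⟨((r ^ k)⁻¹ * a * r ^ k) :: l', ?_, by simp; omega, ?_⟩
      · intro x hx
        rcases List.mem_cons.1 hx with rfl | hx
        · simpa using hconj (r ^ k)⁻¹ a ha
        · exact h₁ x hx
      · rw [List.prod_cons, List.prod_cons, h₃]
        group

theorem List.exists_conj_prod {S : Set G} (hconj : ∀ g : G, ∀ s ∈ S, g * s * g⁻¹ ∈ S)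
    (g : G) (l : List G) (hl : ∀ x ∈ l, x ∈ S) :
    ∃ l' : List G, (∀ x ∈ l', x ∈ S) ∧ l'.length = l.length ∧
      l'.prod = g * l.prod * g⁻¹ := by
  refine ⟨l.map (MulAut.conj g), ?_, by simp, ?_⟩
  · intro x hx
    obtain ⟨y, hy, rfl⟩ := List.mem_map.1 hx
    simpa using hconj g y (hl y hy)
  · rw [← map_list_prod, MulAut.conj_apply]

/-- Modulo a subgroup, a product of elements of a conjugation-invariant set can be rewritten with
letters from a given set of coset representatives. -/
theorem List.exists_prod_eq_of_representatives {U : Subgroup G} {S R : Set G}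
    (hconj : ∀ g : G, ∀ s ∈ S, g * s * g⁻¹ ∈ S)
    (hR : ∀ s ∈ S, ∃ r ∈ R, (r : G ⧸ U) = s) (n : ℕ) :
    ∀ l : List G, (∀ x ∈ l, x ∈ S) → l.length = n →
      ∃ l' : List G, (∀ x ∈ l', x ∈ R) ∧ l'.length = n ∧ (l'.prod : G ⧸ U) = l.prod := by
  induction n with
  | zero =>
    intro l _ hn
    obtain rfl := List.length_eq_zero_iff.1 hn
    exact ⟨[], by simp, rfl, rfl⟩
  | succ n ih =>
    intro l hl hn
    obtain rfl | ⟨m, c, rfl⟩ := List.eq_nil_or_concat' l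
    · simp at hn
    -- Left cosets allow only the last letter to be replaced. Its representative `r` then moves to
    -- the front, conjugating the remaining letters, and the induction continues on those.
    obtain ⟨r, hr, hrc⟩ := hR c (hl c (by simp))
    obtain ⟨m₁, h₁, h₂, h₃⟩ := List.exists_conj_prod hconj r⁻¹ m fun x hx => hl x (by simp [hx])
    obtain ⟨m₂, k₁, k₂, k₃⟩ := ih m₁ h₁ (by simpa [h₂] using hn)
    refine ⟨r :: m₂, by simpa [hr] using k₁, by simp [k₂], ?_⟩
    have h₄ : m.prod * r = r * m₁.prod := by rw [h₃]; group
    calc ((r :: m₂).prod : G ⧸ U) = r • (m₂.prod : G ⧸ U) := by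
          rw [List.prod_cons]; rfl
      _ = r • (m₁.prod : G ⧸ U) := by rw [k₃]
      _ = ((m.prod * r : G) : G ⧸ U) := by rw [h₄]; rfl
      _ = m.prod • (r : G ⧸ U) := rfl
      _ = m.prod • (c : G ⧸ U) := by rw [hrc]
      _ = ((m ++ [c]).prod : G ⧸ U) := by rw [List.prod_append, List.prod_singleton]; rfl

/-- In a long word over the representatives some `r` occurs `e` times by pigeonhole. Collected into
`r ^ e` and moved to the right end by conjugation, these letters are absorbed by `U`. -/
theorem List.exists_prod_eq_of_length_gt {U : Subgroup G} {S : Set G} {R : Finset G} {e : ℕ}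
    (he : 0 < e) (hconj : ∀ g : G, ∀ s ∈ S, g * s * g⁻¹ ∈ S) (hRS : ∀ r ∈ R, r ∈ S)
    (hR : ∀ s ∈ S, ∃ r ∈ R, (r : G ⧸ U) = s) (hRe : ∀ r ∈ R, r ^ e ∈ U)
    (l : List G) (hl : ∀ x ∈ l, x ∈ S) (hlen : R.card * e < l.length) :
    ∃ l' : List G, (∀ x ∈ l', x ∈ S) ∧ l'.length < l.length ∧
      (l'.prod : G ⧸ U) = l.prod := by
  classical
  obtain ⟨m, hm, hmlen, hmprod⟩ :=
    List.exists_prod_eq_of_representatives (R := (R : Set G)) hconj hR _ l hl rfl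
  obtain ⟨r, hr, hcount⟩ : ∃ r ∈ R, e ≤ m.count r := by
    by_contra! h
    have h₁ : ∑ r ∈ m.toFinset, m.count r ≤ m.toFinset.card * e :=
      Finset.sum_le_card_nsmul _ _ _ fun r hr => (h r (hm r (List.mem_toFinset.1 hr))).le
    have h₂ : m.toFinset.card ≤ R.card :=
      Finset.card_le_card fun r hr => hm r (List.mem_toFinset.1 hr)
    rw [List.sum_toFinset_count_eq_length] at h₁
    have := Nat.mul_le_mul_right e h₂
    omega
  obtain ⟨m₁, h₁, h₂, h₃⟩ := List.exists_pow_mul_prod_of_le_count hconj r m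
    (fun x hx => hRS x (hm x hx)) e hcount
  obtain ⟨m₂, k₁, k₂, k₃⟩ := List.exists_conj_prod hconj (r ^ e) m₁ h₁
  refine ⟨m₂, k₁, by omega, ?_⟩
  rw [← hmprod, h₃, QuotientGroup.eq, k₃]
  have : (r ^ e * m₁.prod * (r ^ e)⁻¹)⁻¹ * (r ^ e * m₁.prod) = r ^ e := by group
  rw [this]
  exact hRe r hr

/-- A relative form of Dicman's lemma: a conjugation-invariant set that meets finitely many cosets
of `U` and whose elements have powers in `U` generates a subgroup meeting finitely many cosets. -/
theorem Subgroup.finite_image_mk_closure {U : Subgroup G} {S : Set G}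
    (hconj : ∀ g : G, ∀ s ∈ S, g * s * g⁻¹ ∈ S) (hinv : ∀ s ∈ S, s⁻¹ ∈ S)
    (hpow : ∀ s ∈ S, ∃ e : ℕ, 0 < e ∧ s ^ e ∈ U)
    (hfin : ((QuotientGroup.mk : G → G ⧸ U) '' S).Finite) :
    ((QuotientGroup.mk : G → G ⧸ U) '' (Subgroup.closure S : Set G)).Finite := by
  classical
  choose! ρ hρS hρ using fun (q : G ⧸ U) (hq : q ∈ (QuotientGroup.mk : G → G ⧸ U) '' S) => hq
  let R : Finset G := hfin.toFinset.image ρ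
  have hRS : ∀ r ∈ R, r ∈ S := by
    intro r hr
    obtain ⟨q, hq, rfl⟩ := Finset.mem_image.1 hr
    exact hρS q (hfin.mem_toFinset.1 hq)
  have hR : ∀ s ∈ S, ∃ r ∈ R, (r : G ⧸ U) = s := fun s hs =>
    ⟨ρ s, Finset.mem_image_of_mem _ (hfin.mem_toFinset.2 ⟨s, hs, rfl⟩), hρ _ ⟨s, hs, rfl⟩⟩
  obtain ⟨e, he, hRe⟩ : ∃ e : ℕ, 0 < e ∧ ∀ r ∈ R, r ^ e ∈ U := by
    choose! ε hε hεU using hpow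
    -- Finiteness of `R` gives a common exponent.
    refine ⟨∏ r ∈ R, ε r, Finset.prod_pos fun r hr => hε r (hRS r hr), fun r hr => ?_⟩
    obtain ⟨k, hk⟩ := Finset.dvd_prod_of_mem ε hr
    rw [hk, pow_mul]
    exact U.pow_mem (hεU r (hRS r hr)) k
  have hshort : ∀ n : ℕ, ∀ l : List G, l.length = n → (∀ x ∈ l, x ∈ S) →
      ∃ l' : List G, (∀ x ∈ l', x ∈ S) ∧ l'.length ≤ R.card * e ∧
        (l'.prod : G ⧸ U) = l.prod := by
    intro n
    induction n using Nat.strong_induction_on with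
    | _ n ih =>
      intro l hn hl
      rcases le_or_gt l.length (R.card * e) with h | h
      · exact ⟨l, hl, h, rfl⟩
      · obtain ⟨m, hm, hlt, hprod⟩ :=
          List.exists_prod_eq_of_length_gt he hconj hRS hR hRe l hl h
        obtain ⟨l', h₁, h₂, h₃⟩ := ih _ (hn ▸ hlt) m rfl hm
        exact ⟨l', h₁, h₂, h₃.trans hprod⟩
  refine ((List.finite_length_le R (R.card * e)).image
    fun l => (((l.map Subtype.val).prod : G) : G ⧸ U)).subset ?_
  rintro _ ⟨g, hg, rfl⟩
  rw [SetLike.mem_coe, ← Subgroup.mem_toSubmonoid, Subgroup.closure_toSubmonoid] at hg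
  obtain ⟨l, hl, rfl⟩ := Submonoid.exists_list_of_mem_closure hg
  obtain ⟨l₁, h₁, h₂, h₃⟩ := hshort _ l rfl fun x hx =>
    (hl x hx).elim id fun h => by simpa using hinv _ h
  -- `S` may be infinite, so the short word is rewritten over the finite alphabet `R`, where words
  -- of bounded length are finite in number.
  obtain ⟨l₂, k₁, k₂, k₃⟩ :=
    List.exists_prod_eq_of_representatives (R := (R : Set G)) hconj hR _ l₁ h₁ rfl
  refine ⟨l₂.attachWith (· ∈ R) k₁, by simp [k₂, h₂], ?_⟩
  simp [k₃, h₃]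

end Dicman

/-! ### Compact open subgroups and their cosets. -/

section Topology

theorem exists_isCompact_isOpen_subgroup (G : Type*) [Group G] [TopologicalSpace G]
    [IsTopologicalGroup G] [LocallyCompactSpace G] [TotallyDisconnectedSpace G] :
    ∃ U : Subgroup G, IsOpen (U : Set G) ∧ IsCompact (U : Set G) := by
  obtain ⟨C, hC, hC1⟩ := exists_compact_mem_nhds (1 : G)
  obtain ⟨W, hW, h1W, hWC⟩ := loc_compact_Haus_tot_disc_of_zero_dim.mem_nhds_iff.1 hC1
  have hWc : IsCompact W := hC.of_isClosed_subset hW.1 hWC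
  -- The subgroup is the stabilizer of `W` under left translation; it lies in `W` because `1 ∈ W`.
  open scoped Pointwise in
  have hle : ((MulAction.stabilizer G W : Subgroup G) : Set G) ⊆ W := by
    intro g hg
    have : g • (1 : G) ∈ g • W := Set.smul_mem_smul_set h1W
    rw [MulAction.mem_stabilizer_iff.1 hg] at this
    simpa using this
  open scoped Pointwise in
  have hopen : IsOpen ((MulAction.stabilizer G W : Subgroup G) : Set G) := by
    obtain ⟨V, hV, hVW⟩ := compact_open_separated_mul_left hWc hW.2 subset_rfl
    refine Subgroup.isOpen_of_mem_nhds _ (g := 1) ?_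
    filter_upwards [hV, inv_mem_nhds_one G hV] with g hg hg'
    replace hg' : g⁻¹ ∈ V := hg'
    refine MulAction.mem_stabilizer_iff.2 (subset_antisymm ?_ ?_)
    · exact (Set.smul_set_subset_mul hg).trans hVW
    · rw [Set.subset_smul_set_iff]
      exact (Set.smul_set_subset_mul hg').trans hVW
  exact ⟨_, hopen, hWc.of_isClosed_subset (Subgroup.isClosed_of_isOpen _ hopen) hle⟩

variable {G : Type*} [Group G] [TopologicalSpace G] [IsTopologicalGroup G]

theorem Subgroup.finite_image_mk_of_isCompact {U : Subgroup G} (hU : IsOpen (U : Set G))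
    {C : Set G} (hC : IsCompact C) : ((QuotientGroup.mk : G → G ⧸ U) '' C).Finite := by
  have := QuotientGroup.discreteTopology hU
  exact (hC.image QuotientGroup.continuous_mk).finite_of_discrete

theorem Subgroup.isCompact_preimage_mk_of_finite {U : Subgroup G} (hU : IsCompact (U : Set G))
    {F : Set (G ⧸ U)} (hF : F.Finite) :
    IsCompact ((QuotientGroup.mk : G → G ⧸ U) ⁻¹' F) := by
  rw [← Set.biUnion_preimage_singleton]
  refine hF.isCompact_biUnion fun q _ => ?_
  obtain ⟨g, rfl⟩ := QuotientGroup.mk_surjective q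
  convert hU.image (continuous_const_mul g) using 1
  ext x
  rw [Set.mem_preimage, Set.mem_singleton_iff, eq_comm, QuotientGroup.eq]
  constructor
  · exact fun h => ⟨_, h, by simp⟩
  · rintro ⟨u, hu, rfl⟩
    simpa using hu

theorem Subgroup.exists_pow_mem_of_isCompact {U H : Subgroup G} (hU : IsOpen (U : Set G))
    (hH : IsCompact (H : Set G)) {h : G} (hh : h ∈ H) : ∃ e : ℕ, 0 < e ∧ h ^ e ∈ U := by
  have hfin := Subgroup.finite_image_mk_of_isCompact hU hH
  obtain ⟨i, -, j, -, hij, heq⟩ := Set.infinite_univ.exists_lt_map_eq_of_mapsTo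
    (f := fun n : ℕ => ((h ^ n : G) : G ⧸ U)) (fun n _ => Set.mem_image_of_mem _ (H.pow_mem hh n)) hfin
  refine ⟨j - i, by omega, ?_⟩
  have := QuotientGroup.eq.1 heq
  rwa [← pow_mul_pow_sub h hij.le, inv_mul_cancel_left] at this

/-- A conjugation-invariant union of compact subgroups meeting finitely many cosets of a compact
open subgroup generates a relatively compact subgroup. -/
theorem Subgroup.isCompact_topologicalClosure_closure {U : Subgroup G} (hUo : IsOpen (U : Set G))
    (hUc : IsCompact (U : Set G)) {S : Set G} (hconj : ∀ g : G, ∀ s ∈ S, g * s * g⁻¹ ∈ S)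
    (hS : ∀ s ∈ S, ∃ H : Subgroup G, s ∈ H ∧ IsCompact (H : Set G) ∧ (H : Set G) ⊆ S)
    (hfin : ((QuotientGroup.mk : G → G ⧸ U) '' S).Finite) :
    IsCompact ((Subgroup.closure S).topologicalClosure : Set G) := by
  have hcl := Subgroup.finite_image_mk_closure hconj
    (fun s hs => let ⟨H, hsH, _, hHS⟩ := hS s hs; hHS (H.inv_mem hsH))
    (fun s hs => let ⟨H, hsH, hH, _⟩ := hS s hs
      Subgroup.exists_pow_mem_of_isCompact hUo hH hsH) hfin
  have := QuotientGroup.discreteTopology hUo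
  refine (Subgroup.isCompact_preimage_mk_of_finite hUc hcl).of_isClosed_subset
    (Subgroup.isClosed_topologicalClosure _) ?_
  exact closure_minimal (Set.subset_preimage_image _ _)
    ((isClosed_discrete _).preimage QuotientGroup.continuous_mk)

end Topology

/-! ### The Chabauty space is compact Hausdorff. -/

section Chabauty

open Filter

variable {G : Type*} [Group G] [TopologicalSpace G]

theorem ClosedSubgroup.isOpen_hit {U : Set G} (hU : IsOpen U) :
    IsOpen {H : ClosedSubgroup G | ((H : Set G) ∩ U).Nonempty} :=
  ⟨_, isOpen_generateFrom_of_mem (Or.inl ⟨U, hU, rfl⟩), rfl⟩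

theorem ClosedSubgroup.isOpen_miss {K : Set G} (hK : IsCompact K) :
    IsOpen {H : ClosedSubgroup G | (H : Set G) ∩ K = ∅} :=
  ⟨_, isOpen_generateFrom_of_mem (Or.inr ⟨K, hK, rfl⟩), rfl⟩

theorem ClosedSubgroup.le_nhds_of_hit_of_miss {f : Filter (ClosedSubgroup G)}
    {H : ClosedSubgroup G}
    (hhit : ∀ U : Set G, IsOpen U → ((H : Set G) ∩ U).Nonempty →
      ∀ᶠ A : ClosedSubgroup G in f, ((A : Set G) ∩ U).Nonempty)
    (hmiss : ∀ K : Set G, IsCompact K → (H : Set G) ∩ K = ∅ →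
      ∀ᶠ A : ClosedSubgroup G in f, (A : Set G) ∩ K = ∅) :
    f ≤ nhds H := by
  rw [@nhds_induced _ _ (chabautyTopology G), ← Filter.map_le_iff_le_comap, nhds_generateFrom]
  refine le_iInf₂ fun s hs => le_principal_iff.2 ?_
  obtain ⟨hHs, ⟨U, hU, rfl⟩ | ⟨K, hK, rfl⟩⟩ := hs
  · exact hhit U hU hHs
  · exact hmiss K hK hHs

instance ClosedSubgroup.chabauty_t2Space [LocallyCompactSpace G] :
    T2Space (ClosedSubgroup G) := by
  have key : ∀ H L : ClosedSubgroup G, ∀ x ∈ H, x ∉ L →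
      ∃ u v : Set (ClosedSubgroup G), IsOpen u ∧ IsOpen v ∧ H ∈ u ∧ L ∈ v ∧ Disjoint u v := by
    intro H L x hxH hxL
    obtain ⟨C, hC, hxC, hCL⟩ := exists_compact_subset L.isClosed'.isOpen_compl hxL
    refine ⟨_, _, ClosedSubgroup.isOpen_hit isOpen_interior, ClosedSubgroup.isOpen_miss hC,
      ⟨x, hxH, hxC⟩, ?_, ?_⟩
    · exact Set.eq_empty_of_forall_notMem fun y hy => hCL hy.2 hy.1
    · refine Set.disjoint_left.2 fun A hA hA' => ?_
      obtain ⟨y, hyA, hyC⟩ := hA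
      exact Set.notMem_empty y (hA' ▸ ⟨hyA, interior_subset hyC⟩)
  refine ⟨fun H L hne => ?_⟩
  by_cases h : ∀ x ∈ H, x ∈ L
  · obtain ⟨x, hxL, hxH⟩ : ∃ x ∈ L, x ∉ H := by
      by_contra! h'
      exact hne (SetLike.ext fun x => ⟨h x, h' x⟩)
    obtain ⟨u, v, hu, hv, hLu, hHv, hd⟩ := key L H x hxL hxH
    exact ⟨v, u, hv, hu, hHv, hLu, hd.symm⟩
  · push Not at h
    obtain ⟨x, hxH, hxL⟩ := h
    exact key H L x hxH hxL

instance ClosedSubgroup.chabauty_compactSpace [IsTopologicalGroup G] :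
    CompactSpace (ClosedSubgroup G) := by
  refine ⟨isCompact_iff_ultrafilter_le_nhds.2 fun f _ => ?_⟩
  -- The ultrafilter limit: points all of whose neighbourhoods meet almost every subgroup.
  let L : Set G := {x | ∀ U : Set G, IsOpen U → x ∈ U →
    ∀ᶠ A : ClosedSubgroup G in f, ((A : Set G) ∩ U).Nonempty}
  have hmul : ∀ x ∈ L, ∀ y ∈ L, x * y ∈ L := by
    intro x hx y hy U hU hxy
    obtain ⟨V, W, hV, hW, hxV, hyW, hVW⟩ :=
      isOpen_prod_iff.1 (hU.preimage continuous_mul) x y hxy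
    filter_upwards [hx V hV hxV, hy W hW hyW]
    rintro A ⟨a, haA, haV⟩ ⟨b, hbA, hbW⟩
    exact ⟨a * b, mul_mem haA hbA, hVW (Set.mk_mem_prod haV hbW)⟩
  have hinv : ∀ x ∈ L, x⁻¹ ∈ L := by
    intro x hx U hU hxU
    filter_upwards [hx _ (hU.preimage continuous_inv) hxU]
    rintro A ⟨a, haA, haU⟩
    exact ⟨a⁻¹, inv_mem haA, haU⟩
  have hone : (1 : G) ∈ L := fun U _ h => Eventually.of_forall fun A => ⟨1, one_mem A, h⟩
  have hclosed : IsClosed L := by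
    refine isOpen_compl_iff.1 (isOpen_iff_forall_mem_open.2 fun x hx => ?_)
    simp only [Set.mem_compl_iff, L, Set.mem_ofPred_eq, not_forall] at hx
    obtain ⟨U, hU, hxU, hf⟩ := hx
    exact ⟨U, fun y hy hyL => hf (hyL U hU hy), hU, hxU⟩
  let H : ClosedSubgroup G :=
    { carrier := L
      mul_mem' := fun {a b} ha hb => hmul a ha b hb
      one_mem' := hone
      inv_mem' := fun {a} ha => hinv a ha
      isClosed' := hclosed }
  refine ⟨H, Set.mem_univ _, ClosedSubgroup.le_nhds_of_hit_of_miss ?_ ?_⟩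
  · rintro U hU ⟨x, hx, hxU⟩
    exact hx U hU hxU
  · intro K hK hHK
    have key : ∀ᶠ A : ClosedSubgroup G in f, ¬ ((A : Set G) ∩ K).Nonempty := by
      refine hK.induction_on (p := fun K => ∀ᶠ A : ClosedSubgroup G in f,
        ¬ ((A : Set G) ∩ K).Nonempty) (by simp) ?_ ?_ ?_
      · intro s t hst ht
        filter_upwards [ht] with A hA hs
        exact hA (hs.mono (Set.inter_subset_inter_right _ hst))
      · intro s t hs ht
        filter_upwards [hs, ht] with A hA hB
        rw [Set.inter_union_distrib_left, Set.union_nonempty]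
        tauto
      · intro x hx
        have hxL : x ∉ L := fun h => (hHK ▸ ⟨h, hx⟩ : x ∈ (∅ : Set G))
        simp only [L, Set.mem_ofPred_eq, not_forall] at hxL
        obtain ⟨U, hU, hxU, hf⟩ := hxL
        -- For an ultrafilter, failing to hit `U` eventually means missing it eventually.
        exact ⟨U, mem_nhdsWithin_of_mem_nhds (hU.mem_nhds hxU), Ultrafilter.eventually_not.2 hf⟩
    filter_upwards [key] with A hA
    exact Set.not_nonempty_iff_eq_empty.1 hA

theorem ClosedSubgroup.continuous_smul (φ : G ≃ₜ* G) :
    Continuous fun H : ClosedSubgroup G => φ • H := by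
  refine continuous_iff_continuousAt.2 fun H =>
    ClosedSubgroup.le_nhds_of_hit_of_miss (fun U hU hH => ?_) fun K hK hH => ?_
  · have : ∀ A : ClosedSubgroup G, (((φ • A : ClosedSubgroup G) : Set G) ∩ U).Nonempty ↔
        ((A : Set G) ∩ φ ⁻¹' U).Nonempty := fun A => Set.image_inter_nonempty_iff
    rw [this] at hH
    rw [Filter.eventually_map]
    simp only [this]
    exact (ClosedSubgroup.isOpen_hit (hU.preimage φ.continuous_toFun)).mem_nhds hH
  · have : ∀ A : ClosedSubgroup G, ((φ • A : ClosedSubgroup G) : Set G) ∩ K = ∅ ↔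
        (A : Set G) ∩ φ ⁻¹' K = ∅ := fun A => by
      rw [← Set.not_nonempty_iff_eq_empty, ← Set.not_nonempty_iff_eq_empty, not_iff_not]
      exact Set.image_inter_nonempty_iff
    rw [this] at hH
    rw [Filter.eventually_map]
    simp only [this]
    exact (ClosedSubgroup.isOpen_miss (φ.toHomeomorph.isCompact_preimage.2 hK)).mem_nhds hH

end Chabauty

/-! ### Baire category, minimality and the main theorem. -/

/-- A lower semicontinuous family of finite sets over a nonempty Baire space is constant on some
nonempty open set. -/
theorem exists_isOpen_forall_eq_finset {X D : Type*} [TopologicalSpace X] [BaireSpace X]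
    [Nonempty X] (p : X → Finset D) (hp : ∀ d, IsOpen {x | d ∈ p x}) :
    ∃ (O : Set X) (t : Finset D), IsOpen O ∧ O.Nonempty ∧ ∀ x ∈ O, p x = t := by
  have hsub : ∀ t : Finset D, IsOpen {x | t ⊆ p x} := by
    intro t
    have : {x | t ⊆ p x} = ⋂ d ∈ t, {x | d ∈ p x} := by
      ext x
      simp [Finset.subset_iff]
    rw [this]
    exact isOpen_biInter_finset fun d _ => hp d
  have hclosed : ∀ n : ℕ, IsClosed {x | (p x).card ≤ n} := by
    intro n
    refine isOpen_compl_iff.1 (isOpen_iff_forall_mem_open.2 fun x hx => ?_)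
    refine ⟨_, fun y hy h => hx ?_, hsub (p x), Finset.Subset.refl (p x)⟩
    exact (Finset.card_le_card hy).trans h
  obtain ⟨n, hn⟩ := nonempty_interior_of_iUnion_of_closed hclosed
    (Set.eq_univ_of_forall fun x => Set.mem_iUnion.2 ⟨(p x).card, Nat.le_refl (p x).card⟩)
  -- Near a point of maximal cardinality the sets contain `p x`, hence equal it.
  obtain ⟨x, hx, hmax⟩ : ∃ x ∈ interior {x | (p x).card ≤ n},
      ∀ y ∈ interior {x | (p x).card ≤ n}, (p y).card ≤ (p x).card := by
    have hbdd : BddAbove ((fun x => (p x).card) '' interior {x | (p x).card ≤ n}) :=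
      ⟨n, by
        rintro _ ⟨x, hx, rfl⟩
        exact (interior_subset hx : x ∈ {x | (p x).card ≤ n})⟩
    obtain ⟨x, hx, hxe⟩ := Nat.sSup_mem (hn.image _) hbdd
    exact ⟨x, hx, fun y hy => (le_csSup hbdd ⟨y, hy, rfl⟩).trans hxe.ge⟩
  refine ⟨interior {x | (p x).card ≤ n} ∩ {y | p x ⊆ p y}, p x,
    isOpen_interior.inter (hsub _), ⟨x, hx, Finset.Subset.refl (p x)⟩, fun y hy => ?_⟩
  exact (Finset.eq_of_subset_of_card_le hy.2 (hmax y hy.1)).symm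

/-- The points of `Y` whose orbit avoids `O` form a closed invariant proper subset, which minimality
forces to be empty. -/
theorem IsMinimalSubsystem.exists_smul_mem {Γ X : Type*} [Group Γ] [MulAction Γ X]
    [TopologicalSpace X] {Y : Set X} (hY : IsMinimalSubsystem Γ Y)
    (hc : ∀ γ : Γ, Continuous fun x : X => γ • x) {O : Set X} (hO : IsOpen O)
    (hne : (Y ∩ O).Nonempty) {y : X} (hy : y ∈ Y) : ∃ γ : Γ, γ • y ∈ O := by
  by_contra! h
  have hZ := hY.minimal {z ∈ Y | ∀ γ : Γ, γ • z ∉ O} (fun z hz => hz.1) ⟨y, hy, h⟩ ?_ ?_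
  · obtain ⟨z, hzY, hzO⟩ := hne
    rw [← hZ] at hzY
    exact hzY.2 1 (by rwa [one_smul])
  · have : {z ∈ Y | ∀ γ : Γ, γ • z ∉ O} = Y ∩ ⋂ γ : Γ, (fun z : X => γ • z) ⁻¹' Oᶜ := by
      ext z
      simp
    rw [this]
    exact hY.isClosed.inter (isClosed_iInter fun γ => hO.isClosed_compl.preimage (hc γ))
  · rintro γ z ⟨hz, hz'⟩
    exact ⟨hY.invariant γ z hz, fun δ => by rw [smul_smul]; exact hz' _⟩

/-- The union of a minimal subgroup system of compact subgroups meets finitely many cosets of any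
compact open subgroup. -/
theorem IsMinimalSubgroupSystem.finite_image_mk_iUnion {G : Type*} [Group G] [TopologicalSpace G]
    [IsTopologicalGroup G] [LocallyCompactSpace G] {Γ : Subgroup (G ≃ₜ* G)}
    {Y : Set (ClosedSubgroup G)} (hY : IsMinimalSubgroupSystem Γ Y)
    (hYc : ∀ H ∈ Y, IsCompact (H : Set G)) {U : Subgroup G} (hUo : IsOpen (U : Set G))
    (hUc : IsCompact (U : Set G)) :
    ((QuotientGroup.mk : G → G ⧸ U) '' ⋃ H ∈ Y, (H : Set G)).Finite := by
  have hY' : IsMinimalSubsystem Γ Y := hY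
  have hcpt : IsCompact Y := hY'.isClosed.isCompact
  have : CompactSpace Y := isCompact_iff_compactSpace.1 hcpt
  have : Nonempty Y := hY'.nonempty.to_subtype
  have hfin : ∀ A : Y, ((QuotientGroup.mk : G → G ⧸ U) '' (A.1 : Set G)).Finite := fun A =>
    Subgroup.finite_image_mk_of_isCompact hUo (hYc A.1 A.2)
  have := QuotientGroup.discreteTopology hUo
  obtain ⟨O, t, hO, ⟨A₀, hA₀⟩, hOt⟩ := exists_isOpen_forall_eq_finset
    (fun A : Y => (hfin A).toFinset) fun q => by
      have : {A : Y | q ∈ (hfin A).toFinset} = Subtype.val ⁻¹' {H : ClosedSubgroup G |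
          ((H : Set G) ∩ (QuotientGroup.mk : G → G ⧸ U) ⁻¹' {q}).Nonempty} := by
        ext A
        simp only [Set.Finite.mem_toFinset]
        rfl
      rw [this]
      exact (ClosedSubgroup.isOpen_hit ((isOpen_discrete _).preimage
        QuotientGroup.continuous_mk)).preimage continuous_subtype_val
  obtain ⟨O', hO', rfl⟩ := hO
  have hcont : ∀ γ : Γ, Continuous fun H : ClosedSubgroup G => γ • H :=
    fun γ => ClosedSubgroup.continuous_smul γ.1
  obtain ⟨s, hs⟩ := hcpt.elim_finite_subcover (fun γ : Γ => (fun H => γ • H) ⁻¹' O')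
    (fun γ => hO'.preimage (hcont γ)) fun A hA => Set.mem_iUnion.2
      (hY'.exists_smul_mem hcont hO' ⟨A₀.1, A₀.2, hA₀⟩ hA)
  have hT : IsCompact ((QuotientGroup.mk : G → G ⧸ U) ⁻¹' (t : Set (G ⧸ U))) :=
    Subgroup.isCompact_preimage_mk_of_finite hUc t.finite_toSet
  -- Automorphisms need not permute the cosets of `U`, so the bound is carried back as a compact set
  -- and only then counted in cosets.
  have hcov : IsCompact (⋃ γ ∈ s, (γ : G ≃ₜ* G) ⁻¹'
      ((QuotientGroup.mk : G → G ⧸ U) ⁻¹' (t : Set (G ⧸ U)))) :=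
    s.isCompact_biUnion fun γ _ => (γ : G ≃ₜ* G).toHomeomorph.isCompact_preimage.2 hT
  refine (Subgroup.finite_image_mk_of_isCompact hUo hcov).subset (Set.image_mono ?_)
  refine Set.iUnion₂_subset fun A hA x hx => ?_
  obtain ⟨γ, hγ, hγA⟩ := Set.mem_iUnion₂.1 (hs hA)
  refine Set.mem_iUnion₂.2 ⟨γ, hγ, ?_⟩
  have h := hOt ⟨γ • A, hY'.invariant γ A hA⟩ hγA
  have hx' : (((γ : G ≃ₜ* G) x : G) : G ⧸ U) ∈
      (hfin ⟨γ • A, hY'.invariant γ A hA⟩).toFinset :=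
    (Set.Finite.mem_toFinset _).2 ⟨_, ⟨x, hx, rfl⟩, rfl⟩
  rw [h] at hx'
  exact hx'

theorem IsMinimalSubgroupSystem.exists_isCompact_invariant {G : Type*} [Group G]
    [TopologicalSpace G] [IsTopologicalGroup G] [LocallyCompactSpace G]
    [TotallyDisconnectedSpace G] {Γ : Subgroup (G ≃ₜ* G)} (hΓ : Inn G ≤ Γ)
    {Y : Set (ClosedSubgroup G)} (hY : IsMinimalSubgroupSystem Γ Y)
    (hYc : ∀ H ∈ Y, IsCompact (H : Set G)) :
    ∃ K : Subgroup G, IsCompact (K : Set G) ∧ (∀ φ ∈ Γ, φ '' (K : Set G) = (K : Set G)) ∧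
      (⋃ H ∈ Y, (H : Set G)) ⊆ (K : Set G) := by
  obtain ⟨U, hUo, hUc⟩ := exists_isCompact_isOpen_subgroup G
  set S : Set G := ⋃ H ∈ Y, (H : Set G)
  have hinv : ∀ φ ∈ Γ, ∀ s ∈ S, φ s ∈ S := by
    intro φ hφ s hs
    obtain ⟨H, hH, hsH⟩ := Set.mem_iUnion₂.1 hs
    exact Set.mem_iUnion₂.2 ⟨_, IsMinimalSubsystem.invariant hY ⟨φ, hφ⟩ H hH, s, hsH, rfl⟩
  have hSK : S ⊆ (Subgroup.closure S).topologicalClosure :=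
    Subgroup.subset_closure.trans (Subgroup.le_topologicalClosure _)
  have hK : ∀ φ ∈ Γ, ∀ x ∈ (Subgroup.closure S).topologicalClosure,
      φ x ∈ (Subgroup.closure S).topologicalClosure := by
    intro φ hφ
    have : (Subgroup.closure S).topologicalClosure ≤
        (Subgroup.closure S).topologicalClosure.comap φ.toMulEquiv.toMonoidHom :=
      Subgroup.topologicalClosure_minimal _
        ((Subgroup.closure_le _).2 fun s hs => hSK (hinv φ hφ s hs))
        ((Subgroup.isClosed_topologicalClosure _).preimage φ.continuous_toFun)
    exact this
  refine ⟨(Subgroup.closure S).topologicalClosure, ?_, fun φ hφ => ?_, hSK⟩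
  · refine Subgroup.isCompact_topologicalClosure_closure hUo hUc
      (fun g s hs => hinv (innerAut g) (hΓ ⟨g, rfl⟩) s hs) (fun s hs => ?_)
      (hY.finite_image_mk_iUnion hYc hUo hUc)
    obtain ⟨H, hH, hsH⟩ := Set.mem_iUnion₂.1 hs
    exact ⟨H.toSubgroup, hsH, hYc H hH, fun x hx => Set.mem_iUnion₂.2 ⟨H, hH, hx⟩⟩
  · refine subset_antisymm (Set.image_subset_iff.2 (hK φ hφ)) fun x hx => ?_
    -- Stability under `φ⁻¹` gives the reverse inclusion.
    exact ⟨φ.symm x, hK φ⁻¹ (Γ.inv_mem hφ) x hx, φ.apply_symm_apply x⟩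

theorem mainTheorem5 {G : Type*} [Group G] [TopologicalSpace G] [IsTopologicalGroup G]
    [LocallyCompactSpace G] [TotallyDisconnectedSpace G] :
    (∀ Γ : Subgroup (G ≃ₜ* G), Inn G ≤ Γ →
      ∀ Y : Set (ClosedSubgroup G), IsMinimalSubgroupSystem Γ Y →
        (∀ H ∈ Y, IsCompact (H : Set G)) →
        ∃ K : Subgroup G, IsCompact (K : Set G) ∧
          (∀ φ ∈ Γ, φ '' (K : Set G) = (K : Set G)) ∧
          (⋃ H ∈ Y, (H : Set G)) ⊆ (K : Set G)) ∧
    (∀ Y : Set (ClosedSubgroup G), IsURS Y →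
      (∀ H ∈ Y, IsCompact (H : Set G)) →
      ∃ K : Subgroup G, IsCompact (K : Set G) ∧ K.Normal ∧
        (⋃ H ∈ Y, (H : Set G)) ⊆ (K : Set G)) := by
  refine ⟨fun Γ hΓ Y hY hYc => hY.exists_isCompact_invariant hΓ hYc, fun Y hY hYc => ?_⟩
  obtain ⟨K, hK, hinv, hYK⟩ :=
    IsMinimalSubgroupSystem.exists_isCompact_invariant le_rfl hY hYc
  refine ⟨K, hK, ⟨fun x hx g => ?_⟩, hYK⟩
  have h : innerAut g x ∈ innerAut g '' (K : Set G) := ⟨x, hx, rfl⟩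
  rw [hinv (innerAut g) ⟨g, rfl⟩] at h
  exact h
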